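/- A Young function is a convex function $\Phi:\mathbb{R}\to[0,\infty]$ with $\Phi(-x)=\Phi(x)$, $\Phi(0)=0$ and $\lim_{x\to\infty}\Phi(x)=\infty$. Its generalized inverse is $\Phi^{-1}(y)=\inf\{x\ge 0:\Phi(x)>y\}$ for $y\in[0,\infty]$, with $\inf\emptyset=\infty$ (so $\Phi^{-1}(\infty)=\infty$). $\Phi$ satisfies the $\Delta_2$-condition globally if there is $K>0$ with $\Phi(2x)\le K\Phi(x)$ for all $x\ge 0$. For a measure space $(X,\mathcal{F},\mu)$, the Orlicz space $L^\Phi(\mu)$ consists of the measurable functions $f:X\to\mathbb{R}$ (modulo equality $\mu$-almost everywhere) with $\int_X\Phi(kf)\,d\mu<\infty$ for some $k>0$, with the norm $N_\Phi(f)=\inf\{k>0:\int_X\Phi(f/k)\,d\mu\le 1\}$. A self-map $T$ of a metric space $(M,d)$ is Li-Yorke chaotic if there is an uncountable set $S\subseteq M$ such that $\liminf_{n\to\infty} d(T^nx,T^ny)=0$ and $\limsup_{n\to\infty} d(T^nx,T^ny)>0$ for all distinct $x,y\in S$. Let $(X,\mathcal{F},\mu)$ be a measure space, let $\Phi$ be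 a Young function, and let $\varphi:X\to X$ be measurable and non-singular ($\mu(F)=0$ implies $\mu(\varphi^{-1}(F))=0$). Suppose that $C_\varphi f=f\circ\varphi$ maps $L^\Phi(\mu)$ into itself and is continuous there. Consider the condition (C) there exist a non-empty countable collection $\{F_i\}_{i\in I}$ of measurable sets with $0<\mu(F_i)<\infty$ and a strictly increasing sequence $(\beta_j)_{j\in\mathbb{N}}$ of natural numbers such that (I) $\displaystyle\lim_{j\to\infty}\Phi^{-1}\Big(\frac{1}{\mu(\varphi^{-\beta_j}(F_i))}\Big)=\infty$ for all $i\in I$, and (II) $\displaystyle\sup\left\{\frac{\Phi^{-1}(1/\mu(F_i))}{\Phi^{-1}(1/\mu(\varphi^{-n}(F_i)))}: i\in I,\ n\in\mathbb{N}\right\}=\infty$, with the conventions $1/0=\infty$, $1/\infty=0$, $0/0=0$, and $a/\infty=0$ for finite $a$. Then (C) implies that $C_\varphi$ is Li-Yorke chaotic on $L^\Phi(\mu)$. If moreover $\Phi$ satisfies the $\Delta_2$-condition globally, then $C_\varphi$ is Li-Yorke chaotic on $L^\Phi(\mu)$ if and only if (C) holds. -/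

import Mathlib

open Set Filter Topology MeasureTheory
open scoped NNReal ENNReal

/-- A Young function: convex, even, `Φ 0 = 0`, `Φ x → ∞` as `x → ∞`, with values in `[0, ∞]`. -/
structure YoungFunction where
  toFun : ℝ → ℝ≥0∞
  convex' : ConvexOn ℝ≥0 univ toFun
  even' : ∀ x, toFun (-x) = toFun x
  zero' : toFun 0 = 0
  tendsto' : Tendsto toFun atTop (𝓝 ⊤)

namespace YoungFunction

instance : CoeFun YoungFunction (fun _ => ℝ → ℝ≥0∞) := ⟨YoungFunction.toFun⟩

/-- The generalized inverse `Φ⁻¹(y) = inf {x ≥ 0 : Φ(x) > y}`, with `inf ∅ = ∞`,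
so that `Φ⁻¹(∞) = ∞`. -/
noncomputable def inv (Φ : YoungFunction) (y : ℝ≥0∞) : ℝ≥0∞ :=
  ⨅ (x : ℝ≥0) (_ : y < Φ (x : ℝ)), (x : ℝ≥0∞)

/-- The global `Δ₂`-condition. -/
def GlobalDelta2 (Φ : YoungFunction) : Prop :=
  ∃ K : ℝ≥0, 0 < K ∧ ∀ x : ℝ, 0 ≤ x → Φ (2 * x) ≤ (K : ℝ≥0∞) * Φ x

theorem conv_le (Φ : YoungFunction) {a b : ℝ} (ha : 0 ≤ a) (hb : 0 ≤ b) (hab : a + b = 1)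
    (x y : ℝ) : Φ (a * x + b * y) ≤ ENNReal.ofReal a * Φ x + ENNReal.ofReal b * Φ y := by
  lift a to ℝ≥0 using ha
  lift b to ℝ≥0 using hb
  have h := Φ.convex'.2 (mem_univ x) (mem_univ y) (zero_le (a := a)) (zero_le (a := b))
    (by exact_mod_cast hab)
  simpa [NNReal.smul_def, ENNReal.smul_def] using h

theorem mul_le (Φ : YoungFunction) {a : ℝ} (ha : 0 ≤ a) (ha1 : a ≤ 1) (x : ℝ) :
    Φ (a * x) ≤ ENNReal.ofReal a * Φ x := by
  have h := Φ.conv_le ha (sub_nonneg.2 ha1) (by ring) x 0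
  simpa [Φ.zero'] using h

theorem apply_abs (Φ : YoungFunction) (x : ℝ) : Φ |x| = Φ x := by
  rcases abs_choice x with h | h <;> simp [h, Φ.even']

theorem mono (Φ : YoungFunction) {x y : ℝ} (h : |x| ≤ |y|) : Φ x ≤ Φ y := by
  rw [← Φ.apply_abs x, ← Φ.apply_abs y]
  rcases eq_or_ne y 0 with rfl | hy
  · have : |x| = 0 := le_antisymm (by simpa using h) (abs_nonneg x)
    simp [this]
  · have hy' : 0 < |y| := abs_pos.2 hy
    have h1 : |x| / |y| ≤ 1 := (div_le_one hy').2 h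
    have h2 := Φ.mul_le (div_nonneg (abs_nonneg x) hy'.le) h1 |y|
    rw [div_mul_cancel₀ _ hy'.ne'] at h2
    exact h2.trans (mul_le_of_le_one_left' (by simpa using h1))

theorem measurable (Φ : YoungFunction) : Measurable Φ := by
  have hm : Monotone (fun x : ℝ => Φ (max x 0)) := fun x y hxy =>
    Φ.mono (by
      rw [abs_of_nonneg (le_max_right _ _), abs_of_nonneg (le_max_right _ _)]
      exact max_le_max_right 0 hxy)
  have : (Φ : ℝ → ℝ≥0∞) = fun x => Φ (max |x| 0) := by
    funext x
    rw [max_eq_left (abs_nonneg x), Φ.apply_abs]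
  rw [this]
  exact hm.measurable.comp measurable_norm

end YoungFunction

section Orlicz

variable {X : Type*} [MeasurableSpace X]

theorem lintegral_young_mul_le (Φ : YoungFunction) (μ : Measure X) {a : ℝ} (ha : 0 ≤ a)
    (ha1 : a ≤ 1) (g : X → ℝ) :
    ∫⁻ x, Φ (a * g x) ∂μ ≤ ENNReal.ofReal a * ∫⁻ x, Φ (g x) ∂μ := by
  rw [← lintegral_const_mul' _ _ ENNReal.ofReal_ne_top]
  exact lintegral_mono fun x => Φ.mul_le ha ha1 _

theorem lintegral_young_conv_le (Φ : YoungFunction) (μ : Measure X) {a b : ℝ} (ha : 0 ≤ a)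
    (hb : 0 ≤ b) (hab : a + b = 1) {f : X → ℝ} (hf : AEMeasurable f μ) (g : X → ℝ) :
    ∫⁻ x, Φ (a * f x + b * g x) ∂μ ≤
      ENNReal.ofReal a * ∫⁻ x, Φ (f x) ∂μ + ENNReal.ofReal b * ∫⁻ x, Φ (g x) ∂μ := by
  have hm : AEMeasurable (fun x => ENNReal.ofReal a * Φ (f x)) μ :=
    (Φ.measurable.comp_aemeasurable hf).const_mul _
  rw [← lintegral_const_mul' _ _ ENNReal.ofReal_ne_top,
    ← lintegral_const_mul' _ _ ENNReal.ofReal_ne_top, ← lintegral_add_left' hm]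
  exact lintegral_mono fun x => Φ.conv_le ha hb hab _ _

/-- The Orlicz space `L^Φ(μ)` of (classes of) real functions `f` with
`∫ Φ(k f) dμ < ∞` for some `k > 0`. -/
def orliczSpace (Φ : YoungFunction) (μ : Measure X) : Submodule ℝ (X →ₘ[μ] ℝ) where
  carrier := {f | ∃ k : ℝ, 0 < k ∧ ∫⁻ x, Φ (k * f x) ∂μ < ⊤}
  zero_mem' := by
    refine ⟨1, one_pos, ?_⟩
    have : ∫⁻ x, Φ (1 * (0 : X →ₘ[μ] ℝ) x) ∂μ = ∫⁻ _, 0 ∂μ := by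
      refine lintegral_congr_ae ?_
      filter_upwards [AEEqFun.coeFn_zero (α := X) (β := ℝ) (μ := μ)] with x hx
      simp [hx, Φ.zero']
    rw [this]; simp
  add_mem' := by
    rintro f g ⟨k, hk, hf⟩ ⟨l, hl, hg⟩
    have hkl : 0 < k + l := add_pos hk hl
    refine ⟨k * l / (k + l), by positivity, ?_⟩
    have h1 : ∫⁻ x, Φ (k * l / (k + l) * (f + g : X →ₘ[μ] ℝ) x) ∂μ
        = ∫⁻ x, Φ (l / (k + l) * (k * f x) + k / (k + l) * (l * g x)) ∂μ := by
      refine lintegral_congr_ae ?_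
      filter_upwards [AEEqFun.coeFn_add f g] with x hx
      simp only [hx, Pi.add_apply]
      congr 1
      ring
    rw [h1]
    refine (lintegral_young_conv_le Φ μ (by positivity) (by positivity) (by field_simp; ring)
      (f.aemeasurable.const_mul k) _).trans_lt ?_
    exact ENNReal.add_lt_top.2 ⟨ENNReal.mul_lt_top ENNReal.ofReal_lt_top hf,
      ENNReal.mul_lt_top ENNReal.ofReal_lt_top hg⟩
  smul_mem' := by
    rintro c f ⟨k, hk, hf⟩
    refine ⟨k / (|c| + 1), by positivity, lt_of_le_of_lt ?_ hf⟩
    refine lintegral_mono_ae ?_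
    filter_upwards [AEEqFun.coeFn_smul c f] with x hx
    refine Φ.mono ?_
    have h1 : |c| / (|c| + 1) ≤ 1 := (div_le_one (by positivity)).2 (by linarith)
    have h2 : |k / (|c| + 1) * (c • f : X →ₘ[μ] ℝ) x| = |c| / (|c| + 1) * |k * f x| := by
      rw [hx]
      simp only [Pi.smul_apply, smul_eq_mul, abs_mul, abs_div,
        abs_of_pos (show 0 < |c| + 1 by positivity)]
      ring
    rw [h2]
    exact mul_le_of_le_one_left (abs_nonneg _) h1

/-- The gauge (Luxemburg) functional `N_Φ(f) = inf {k > 0 : ∫ Φ(f / k) dμ ≤ 1}`. -/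
noncomputable def gaugeNorm (Φ : YoungFunction) (μ : Measure X) (f : X →ₘ[μ] ℝ) : ℝ :=
  sInf {k : ℝ | 0 < k ∧ ∫⁻ x, Φ (f x / k) ∂μ ≤ 1}

theorem gauge_bddBelow (Φ : YoungFunction) (μ : Measure X) (f : X →ₘ[μ] ℝ) :
    BddBelow {k : ℝ | 0 < k ∧ ∫⁻ x, Φ (f x / k) ∂μ ≤ 1} :=
  ⟨0, fun _ hk => hk.1.le⟩

theorem gauge_nonempty (Φ : YoungFunction) (μ : Measure X) {f : X →ₘ[μ] ℝ}
    (hf : f ∈ orliczSpace Φ μ) : {k : ℝ | 0 < k ∧ ∫⁻ x, Φ (f x / k) ∂μ ≤ 1}.Nonempty := by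
  obtain ⟨k, hk, hfk⟩ := hf
  set A := ∫⁻ x, Φ (k * f x) ∂μ with hA
  have hA' : 0 ≤ A.toReal := ENNReal.toReal_nonneg
  set a : ℝ := 1 / (A.toReal + 1) with ha
  have ha0 : 0 < a := by positivity
  have ha1 : a ≤ 1 := (div_le_one (by positivity)).2 (by linarith)
  refine ⟨1 / (a * k), by positivity, ?_⟩
  have h1 : ∀ x, f x / (1 / (a * k)) = a * (k * f x) := fun x => by field_simp
  simp only [h1]
  refine (lintegral_young_mul_le Φ μ ha0.le ha1 _).trans ?_
  rw [← hA, ← ENNReal.ofReal_toReal hfk.ne, ← ENNReal.ofReal_mul ha0.le]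
  rw [← ENNReal.ofReal_one]
  refine ENNReal.ofReal_le_ofReal ?_
  rw [ha, one_div_mul_eq_div]
  exact (div_le_one (by positivity)).2 (by linarith)

theorem gaugeNorm_nonneg (Φ : YoungFunction) (μ : Measure X) (f : X →ₘ[μ] ℝ) :
    0 ≤ gaugeNorm Φ μ f :=
  Real.sInf_nonneg fun _ hk => hk.1.le

theorem gaugeNorm_add_le (Φ : YoungFunction) (μ : Measure X) {f g : X →ₘ[μ] ℝ}
    (hf : f ∈ orliczSpace Φ μ) (hg : g ∈ orliczSpace Φ μ) :
    gaugeNorm Φ μ (f + g) ≤ gaugeNorm Φ μ f + gaugeNorm Φ μ g := by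
  refine le_of_forall_pos_le_add fun ε hε => ?_
  obtain ⟨k, ⟨hk, hfk⟩, hk'⟩ := exists_lt_of_csInf_lt (gauge_nonempty Φ μ hf)
    (show gaugeNorm Φ μ f < gaugeNorm Φ μ f + ε / 2 by linarith)
  obtain ⟨l, ⟨hl, hgl⟩, hl'⟩ := exists_lt_of_csInf_lt (gauge_nonempty Φ μ hg)
    (show gaugeNorm Φ μ g < gaugeNorm Φ μ g + ε / 2 by linarith)
  have hkl : 0 < k + l := add_pos hk hl
  have hsum : k / (k + l) + l / (k + l) = 1 := by field_simp
  have : gaugeNorm Φ μ (f + g) ≤ k + l := by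
    refine csInf_le (gauge_bddBelow Φ μ _) ⟨hkl, ?_⟩
    have h1 : ∫⁻ x, Φ ((f + g : X →ₘ[μ] ℝ) x / (k + l)) ∂μ
        = ∫⁻ x, Φ (k / (k + l) * (f x / k) + l / (k + l) * (g x / l)) ∂μ := by
      refine lintegral_congr_ae ?_
      filter_upwards [AEEqFun.coeFn_add f g] with x hx
      simp only [hx, Pi.add_apply]
      congr 1
      field_simp
    rw [h1]
    refine (lintegral_young_conv_le Φ μ (by positivity) (by positivity) hsum
      (f.aemeasurable.div_const k) _).trans ?_
    calc _ ≤ ENNReal.ofReal (k / (k + l)) * 1 + ENNReal.ofReal (l / (k + l)) * 1 := by gcongr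
      _ = 1 := by
        rw [mul_one, mul_one, ← ENNReal.ofReal_add (by positivity) (by positivity), hsum,
          ENNReal.ofReal_one]
  linarith

theorem gaugeNorm_smul_le (Φ : YoungFunction) (μ : Measure X) {f : X →ₘ[μ] ℝ}
    (hf : f ∈ orliczSpace Φ μ) (c : ℝ) :
    gaugeNorm Φ μ (c • f) ≤ |c| * gaugeNorm Φ μ f := by
  refine le_of_forall_pos_le_add fun ε hε => ?_
  have hc : 0 < |c| + 1 := by positivity
  obtain ⟨k, ⟨hk, hfk⟩, hk'⟩ := exists_lt_of_csInf_lt (gauge_nonempty Φ μ hf)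
    (show gaugeNorm Φ μ f < gaugeNorm Φ μ f + ε / 2 / (|c| + 1) by
      have : 0 < ε / 2 / (|c| + 1) := by positivity
      linarith)
  have hl : 0 < |c| * k + ε / 2 := by positivity
  have h1 : gaugeNorm Φ μ (c • f) ≤ |c| * k + ε / 2 := by
    refine csInf_le (gauge_bddBelow Φ μ _) ⟨hl, le_trans (lintegral_mono_ae ?_) hfk⟩
    filter_upwards [AEEqFun.coeFn_smul c f] with x hx
    refine Φ.mono ?_
    rw [hx, Pi.smul_apply, smul_eq_mul, abs_div, abs_div, abs_mul, abs_of_pos hl, abs_of_pos hk,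
      div_le_div_iff₀ hl hk]
    nlinarith [abs_nonneg (f x), mul_nonneg (abs_nonneg (f x)) hε.le]
  have h2 : |c| * k ≤ |c| * gaugeNorm Φ μ f + ε / 2 := by
    have h3 : |c| * k ≤ |c| * (gaugeNorm Φ μ f + ε / 2 / (|c| + 1)) :=
      mul_le_mul_of_nonneg_left hk'.le (abs_nonneg c)
    have h4 : |c| * (ε / 2 / (|c| + 1)) ≤ ε / 2 := by
      rw [mul_div_assoc', div_le_iff₀ hc]
      nlinarith
    linarith [mul_add |c| (gaugeNorm Φ μ f) (ε / 2 / (|c| + 1))]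
  linarith

theorem gaugeNorm_smul (Φ : YoungFunction) (μ : Measure X) {f : X →ₘ[μ] ℝ}
    (hf : f ∈ orliczSpace Φ μ) (c : ℝ) :
    gaugeNorm Φ μ (c • f) = |c| * gaugeNorm Φ μ f := by
  refine le_antisymm (gaugeNorm_smul_le Φ μ hf c) ?_
  rcases eq_or_ne c 0 with rfl | hc
  · simpa using gaugeNorm_nonneg Φ μ _
  · have h := gaugeNorm_smul_le Φ μ ((orliczSpace Φ μ).smul_mem c hf) c⁻¹
    rw [smul_smul, inv_mul_cancel₀ hc, one_smul, abs_inv] at h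
    have hc' : 0 < |c| := abs_pos.2 hc
    calc |c| * gaugeNorm Φ μ f ≤ |c| * (|c|⁻¹ * gaugeNorm Φ μ (c • f)) := by gcongr
      _ = gaugeNorm Φ μ (c • f) := by field_simp

theorem eq_zero_of_gaugeNorm_eq_zero (Φ : YoungFunction) (μ : Measure X) {f : X →ₘ[μ] ℝ}
    (hf : f ∈ orliczSpace Φ μ) (h0 : gaugeNorm Φ μ f = 0) : f = 0 := by
  have hall : ∀ k : ℝ, 0 < k → ∫⁻ x, Φ (f x / k) ∂μ ≤ 1 := by
    intro k hk
    obtain ⟨l, ⟨hl, hfl⟩, hl'⟩ := exists_lt_of_csInf_lt (gauge_nonempty Φ μ hf)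
      (show gaugeNorm Φ μ f < k by rw [h0]; exact hk)
    refine le_trans (lintegral_mono fun x => Φ.mono ?_) hfl
    rw [abs_div, abs_div, abs_of_pos hk, abs_of_pos hl]
    exact div_le_div_of_nonneg_left (abs_nonneg _) hl hl'.le
  have hnull : ∀ δ : ℝ, 0 < δ → μ {x | δ ≤ |f x|} = 0 := by
    intro δ hδ
    by_contra hne
    have hb : ∀ t : ℝ, 0 < t → Φ (δ * t) * μ {x | δ ≤ |f x|} ≤ 1 := by
      intro t ht
      have hsub : {x | δ ≤ |f x|} ⊆ {x | Φ (δ * t) ≤ Φ (f x / t⁻¹)} := fun x hx => by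
        refine Φ.mono ?_
        rw [div_inv_eq_mul, abs_mul, abs_mul, abs_of_pos hδ]
        exact mul_le_mul_of_nonneg_right hx (abs_nonneg t)
      calc Φ (δ * t) * μ {x | δ ≤ |f x|}
          ≤ Φ (δ * t) * μ {x | Φ (δ * t) ≤ Φ (f x / t⁻¹)} := by gcongr
        _ ≤ ∫⁻ x, Φ (f x / t⁻¹) ∂μ := mul_meas_ge_le_lintegral₀
            (Φ.measurable.comp_aemeasurable (f.aemeasurable.div_const _)) _
        _ ≤ 1 := hall _ (inv_pos.2 ht)
    have ht : Tendsto (fun t : ℝ => Φ (δ * t) * μ {x | δ ≤ |f x|}) atTop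
        (𝓝 (⊤ * μ {x | δ ≤ |f x|})) :=
      ENNReal.Tendsto.mul_const
        (Φ.tendsto'.comp (tendsto_id.const_mul_atTop hδ)) (Or.inl ENNReal.top_ne_zero)
    have hle := le_of_tendsto ht ((eventually_gt_atTop 0).mono hb)
    rw [ENNReal.top_mul hne] at hle
    exact absurd hle (by simp)
  refine AEEqFun.ext ?_
  have hae : ∀ᵐ x ∂μ, ∀ n : ℕ, ¬ (1 / ((n : ℝ) + 1) ≤ |f x|) := by
    rw [ae_all_iff]
    intro n
    have := hnull (1 / ((n : ℝ) + 1)) (by positivity)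
    rw [ae_iff]
    simpa using this
  filter_upwards [hae, AEEqFun.coeFn_zero (α := X) (β := ℝ) (μ := μ)] with x hx hx0
  rw [hx0]
  by_contra hne
  obtain ⟨n, hn⟩ := exists_nat_one_div_lt (abs_pos.2 hne)
  exact hx n hn.le

noncomputable instance (Φ : YoungFunction) (μ : Measure X) : Norm (orliczSpace Φ μ) :=
  ⟨fun f => gaugeNorm Φ μ f⟩

theorem orliczCore (Φ : YoungFunction) (μ : Measure X) :
    NormedSpace.Core ℝ (orliczSpace Φ μ) where
  norm_nonneg f := gaugeNorm_nonneg Φ μ f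
  norm_smul c f := gaugeNorm_smul Φ μ f.2 c
  norm_triangle f g := gaugeNorm_add_le Φ μ f.2 g.2
  norm_eq_zero_iff f := by
    refine ⟨fun h => Subtype.ext (eq_zero_of_gaugeNorm_eq_zero Φ μ f.2 h), ?_⟩
    rintro rfl
    have h := gaugeNorm_smul Φ μ (orliczSpace Φ μ).zero_mem 0
    rw [zero_smul, abs_zero, zero_mul] at h
    exact h

/-- `L^Φ(μ)` with the gauge norm. -/
noncomputable instance (Φ : YoungFunction) (μ : Measure X) :
    NormedAddCommGroup (orliczSpace Φ μ) :=
  NormedAddCommGroup.ofCore (orliczCore Φ μ)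

noncomputable instance (Φ : YoungFunction) (μ : Measure X) : NormedSpace ℝ (orliczSpace Φ μ) :=
  NormedSpace.ofCore (orliczCore Φ μ)

/-- The composition operator `f ↦ f ∘ φ` on `L^Φ(μ)`, for a non-singular measurable `φ`
for which `f ∘ φ` belongs to `L^Φ(μ)` whenever `f` does. -/
noncomputable def compositionOperator (Φ : YoungFunction) (μ : Measure X) (φ : X → X)
    (hφ : Measure.QuasiMeasurePreserving φ μ μ)
    (hmaps : ∀ f ∈ orliczSpace Φ μ, f.compQuasiMeasurePreserving φ hφ ∈ orliczSpace Φ μ) :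
    orliczSpace Φ μ → orliczSpace Φ μ :=
  fun f => ⟨(f : X →ₘ[μ] ℝ).compQuasiMeasurePreserving φ hφ, hmaps f f.2⟩

/-- There are a non-empty countable collection `S` of measurable sets of positive finite measure
and a strictly increasing sequence `β` of natural numbers such that
`Φ⁻¹(1 / μ(φ^{-β j}(F))) → ∞` for every `F ∈ S`, and the ratios
`Φ⁻¹(1 / μ(F)) / Φ⁻¹(1 / μ(φ^{-n}(F)))`, `F ∈ S`, `n ∈ ℕ`, have supremum `∞`.
In `[0, ∞]`: `1 / 0 = ∞`, `1 / ∞ = 0`, `a / ∞ = 0`. -/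
def SetCondition (Φ : YoungFunction) (μ : Measure X) (φ : X → X) : Prop :=
  ∃ (S : Set (Set X)) (β : ℕ → ℕ),
    S.Nonempty ∧ S.Countable ∧ (∀ F ∈ S, MeasurableSet F ∧ 0 < μ F ∧ μ F < ⊤) ∧
    StrictMono β ∧
    (∀ F ∈ S, Tendsto (fun j => Φ.inv (1 / μ (φ^[β j] ⁻¹' F))) atTop (𝓝 ⊤)) ∧
    (⨆ F ∈ S, ⨆ n : ℕ, Φ.inv (1 / μ F) / Φ.inv (1 / μ (φ^[n] ⁻¹' F))) = ⊤

end Orlicz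

/-- Li-Yorke chaos of a self-map of a metric space: there is an uncountable set any two distinct
points of which form a Li-Yorke pair. -/
def LiYorkeChaotic {M : Type*} [MetricSpace M] (T : M → M) : Prop :=
  ∃ S : Set M, ¬ S.Countable ∧ ∀ x ∈ S, ∀ y ∈ S, x ≠ y →
    liminf (fun n : ℕ => edist (T^[n] x) (T^[n] y)) atTop = 0 ∧
    0 < limsup (fun n : ℕ => edist (T^[n] x) (T^[n] y)) atTop

/-!
Characteristic functions satisfy `‖χ_F‖ = 1 / Φ⁻¹(1 / μ(F))`, and the `n`-th iterate of the
composition operator `T` sends `χ_F` to the characteristic function of `φ^{-n}(F)`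
(`ofReal_norm_iterate_indicator`). The set condition therefore says that `T^{β j} χ_F → 0` for all
`F` in the collection and that the ratios `‖T^n χ_F‖ / ‖χ_F‖` are unbounded.

For the direct implication, `L^Φ(μ)` is a Banach space (`orliczSpace_completeSpace`), and so is the
closed span `Y` of these `χ_F`. In `Y` the vectors whose orbit accumulates at `0` and those whose
orbit is unbounded are both generic, so Baire's theorem gives a vector with both properties
(`liYorkeChaotic_of_criterion`); the line through it is a scrambled set
(`liYorkeChaotic_of_irregular`).

For the converse under `Δ₂`, let `f` be the difference of the two points of a Li-Yorke pair. The
collection consists of the preimages `φ^{-m}{2^k < |f| ≤ 2^{k+1}}` of positive measure, and `β` is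
a sequence along which `T^{β j} f → 0`. If the ratios were bounded, `Δ₂` would turn this into
`μ(φ^{-n} G) ≤ M μ(G)` for the sets `G` of the collection
(`YoungFunction.measure_le_of_inv_le`). Cutting `f` into dyadic level sets
(`lintegral_young_le_of_dyadicLevel`), one gets `∫ Φ(T^{m+n} f) ≤ M' ∫ Φ(T^m f)` for all `m`, `n`.
The right side is arbitrarily small for suitable `m`, so the modulars, and by `Δ₂` the norms, of
the whole orbit tend to `0`. That contradicts the positive upper limit of the pair.
-/

/-! ### Completeness of the Orlicz space -/

section Modular

variable {X : Type*} [MeasurableSpace X] {μ : Measure X} {Φ : YoungFunction}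

theorem norm_le_of_lintegral_le_one (f : orliczSpace Φ μ) {k : ℝ} (hk : 0 < k)
    (h : ∫⁻ x, Φ ((f : X →ₘ[μ] ℝ) x / k) ∂μ ≤ 1) : ‖f‖ ≤ k :=
  csInf_le (gauge_bddBelow Φ μ _) ⟨hk, h⟩

theorem lintegral_le_one_of_norm_lt (f : orliczSpace Φ μ) {k : ℝ} (h : ‖f‖ < k) :
    ∫⁻ x, Φ ((f : X →ₘ[μ] ℝ) x / k) ∂μ ≤ 1 := by
  obtain ⟨l, ⟨hl, hfl⟩, hl'⟩ := exists_lt_of_csInf_lt (gauge_nonempty Φ μ f.2) h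
  refine (lintegral_mono fun x => Φ.mono ?_).trans hfl
  rw [abs_div, abs_div, abs_of_pos hl, abs_of_pos (hl.trans hl')]
  exact div_le_div_of_nonneg_left (abs_nonneg _) hl hl'.le

theorem norm_le_of_ae_abs_le {f g : orliczSpace Φ μ}
    (h : ∀ᵐ x ∂μ, |(f : X →ₘ[μ] ℝ) x| ≤ |(g : X →ₘ[μ] ℝ) x|) : ‖f‖ ≤ ‖g‖ := by
  refine le_of_forall_gt_imp_ge_of_dense fun k hk => ?_
  have hk0 : 0 < k := (norm_nonneg g).trans_lt hk
  refine norm_le_of_lintegral_le_one f hk0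
    ((lintegral_mono_ae ?_).trans (lintegral_le_one_of_norm_lt g hk))
  filter_upwards [h] with x hx
  refine Φ.mono ?_
  rw [abs_div, abs_div]
  gcongr

/-- The unit balls of the gauge norm are closed under almost everywhere convergence. Since `Φ` may
jump at the boundary of its domain it need not be lower semicontinuous; enlarging the scaling
constant slightly makes Fatou's lemma applicable nevertheless. -/
theorem exists_norm_le_of_ae_tendsto {h : ℕ → orliczSpace Φ μ} {f : X →ₘ[μ] ℝ} {C : ℝ}
    (hC : ∀ n, ‖h n‖ ≤ C)
    (hf : ∀ᵐ x ∂μ, Tendsto (fun n => (h n : X →ₘ[μ] ℝ) x) atTop (𝓝 (f x))) :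
    ∃ hm : f ∈ orliczSpace Φ μ, ‖(⟨f, hm⟩ : orliczSpace Φ μ)‖ ≤ C := by
  have hC0 : 0 ≤ C := (norm_nonneg _).trans (hC 0)
  have key : ∀ k, C < k → ∫⁻ x, Φ (f x / k) ∂μ ≤ 1 := by
    intro k hk
    obtain ⟨l, hl, hlk⟩ := exists_between hk
    have hl0 : 0 < l := hC0.trans_lt hl
    have hk0 : 0 < k := hl0.trans hlk
    calc ∫⁻ x, Φ (f x / k) ∂μ
        ≤ ∫⁻ x, liminf (fun n => Φ ((h n : X →ₘ[μ] ℝ) x / l)) atTop ∂μ := by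
          refine lintegral_mono_ae ?_
          filter_upwards [hf] with x hx
          refine le_liminf_of_le (by isBoundedDefault) ?_
          rcases eq_or_ne (f x) 0 with h0 | h0
          · simp [h0, Φ.zero']
          · have hlt : |f x| * (l / k) < |f x| :=
              mul_lt_of_lt_one_right (abs_pos.2 h0) ((div_lt_one hk0).2 hlk)
            filter_upwards [hx.abs.eventually (lt_mem_nhds hlt)] with n hn
            refine Φ.mono ?_
            rw [abs_div, abs_div, abs_of_pos hk0, abs_of_pos hl0, le_div_iff₀ hl0]
            calc |f x| / k * l = |f x| * (l / k) := by ring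
              _ ≤ _ := hn.le
      _ ≤ liminf (fun n => ∫⁻ x, Φ ((h n : X →ₘ[μ] ℝ) x / l) ∂μ) atTop :=
          lintegral_liminf_le' fun n =>
            Φ.measurable.comp_aemeasurable ((h n : X →ₘ[μ] ℝ).aemeasurable.div_const _)
      _ ≤ 1 := by
          refine liminf_le_of_le (by isBoundedDefault) fun b hb => ?_
          obtain ⟨n, hn⟩ := hb.exists
          exact hn.trans (lintegral_le_one_of_norm_lt _ ((hC n).trans_lt hl))
  have hm : f ∈ orliczSpace Φ μ := by
    refine ⟨(C + 1)⁻¹, by positivity, ?_⟩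
    have := key (C + 1) (by linarith)
    simp only [div_eq_inv_mul] at this
    exact this.trans_lt ENNReal.one_lt_top
  exact ⟨hm, le_of_forall_gt_imp_ge_of_dense fun k hk =>
    norm_le_of_lintegral_le_one ⟨f, hm⟩ (hC0.trans_lt hk) (key k hk)⟩

theorem coeFn_orlicz_sum (u : ℕ → orliczSpace Φ μ) (s : Finset ℕ) :
    ∀ᵐ x ∂μ, ((∑ i ∈ s, u i : orliczSpace Φ μ) : X →ₘ[μ] ℝ) x
      = ∑ i ∈ s, (u i : X →ₘ[μ] ℝ) x := by
  classical
  induction s using Finset.induction_on with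
  | empty =>
    filter_upwards [AEEqFun.coeFn_zero (α := X) (β := ℝ) (μ := μ)] with x hx
    simpa using hx
  | insert a s ha ih =>
    rw [Finset.sum_insert ha, Submodule.coe_add]
    filter_upwards [ih, AEEqFun.coeFn_add (u a : X →ₘ[μ] ℝ)
      ((∑ i ∈ s, u i : orliczSpace Φ μ) : X →ₘ[μ] ℝ)] with x h1 h2
    rw [h2, Pi.add_apply, h1, Finset.sum_insert ha]

theorem abs_mem_orliczSpace {f : X →ₘ[μ] ℝ} (hf : f ∈ orliczSpace Φ μ) :
    |f| ∈ orliczSpace Φ μ := by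
  obtain ⟨k, hk, h⟩ := hf
  refine ⟨k, hk, lt_of_le_of_lt (lintegral_mono_ae ?_) h⟩
  filter_upwards [AEEqFun.coeFn_abs f] with x hx
  refine Φ.mono ?_
  rw [hx, abs_mul, abs_mul, abs_abs]

theorem ae_summable_abs_of_summable_norm {u : ℕ → orliczSpace Φ μ}
    (hu : Summable fun n => ‖u n‖) :
    ∀ᵐ x ∂μ, Summable fun n => |(u n : X →ₘ[μ] ℝ) x| := by
  let v : ℕ → orliczSpace Φ μ := fun n => ⟨|(u n : X →ₘ[μ] ℝ)|, abs_mem_orliczSpace (u n).2⟩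
  have hv : ∀ n, ∀ᵐ x ∂μ, (v n : X →ₘ[μ] ℝ) x = |(u n : X →ₘ[μ] ℝ) x| :=
    fun n => AEEqFun.coeFn_abs _
  have hvn : ∀ n, ‖v n‖ ≤ ‖u n‖ := fun n => norm_le_of_ae_abs_le (by
    filter_upwards [hv n] with x hx
    rw [hx, abs_abs])
  set K : ℝ := (∑' n, ‖u n‖) + 1 with hK
  have hK0 : 0 < K := by
    have : 0 ≤ ∑' n, ‖u n‖ := tsum_nonneg fun n => norm_nonneg (u n)
    linarith
  have hsum : ∀ n, ∀ᵐ x ∂μ, ((∑ i ∈ Finset.range n, v i : orliczSpace Φ μ) : X →ₘ[μ] ℝ) x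
      = ∑ i ∈ Finset.range n, |(u i : X →ₘ[μ] ℝ) x| := fun n => by
    filter_upwards [coeFn_orlicz_sum v (Finset.range n), ae_all_iff.2 hv] with x h1 h2
    rw [h1]
    exact Finset.sum_congr rfl fun i _ => h2 i
  let G : ℕ → X → ℝ≥0∞ := fun n x => Φ ((∑ i ∈ Finset.range n, |(u i : X →ₘ[μ] ℝ) x|) / K)
  have hGm : ∀ n, Measurable (G n) := fun n => Φ.measurable.comp
    ((Finset.measurable_sum _ fun i _ =>
      (u i : X →ₘ[μ] ℝ).stronglyMeasurable.measurable.abs).div_const K)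
  have hG1 : ∀ n, ∫⁻ x, G n x ∂μ ≤ 1 := by
    intro n
    have hlt : ‖∑ i ∈ Finset.range n, v i‖ < K := by
      have h1 := norm_sum_le (Finset.range n) v
      have h2 := Finset.sum_le_sum fun i (_ : i ∈ Finset.range n) => hvn i
      have h3 := hu.sum_le_tsum (Finset.range n) fun i _ => norm_nonneg _
      linarith
    refine (lintegral_mono_ae ?_).trans (lintegral_le_one_of_norm_lt _ hlt)
    filter_upwards [hsum n] with x hx
    rw [hx]
  have hmono : Monotone G := by
    intro m n hmn x
    refine Φ.mono ?_
    rw [abs_of_nonneg (by positivity), abs_of_nonneg (by positivity)]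
    gcongr
  have hint : ∫⁻ x, ⨆ n, G n x ∂μ ≤ 1 := by
    rw [lintegral_iSup hGm hmono]
    exact iSup_le hG1
  filter_upwards [ae_lt_top (.iSup hGm) (hint.trans_lt ENNReal.one_lt_top).ne] with x hx
  obtain ⟨R, hR, hR0⟩ := ((Φ.tendsto'.eventually (lt_mem_nhds hx)).and
    (eventually_ge_atTop 0)).exists
  refine summable_of_sum_range_le (c := R * K) (fun _ => abs_nonneg _) fun n => ?_
  by_contra! hcon
  have h1 : Φ R ≤ G n x := Φ.mono (by
    rw [abs_of_nonneg hR0, abs_of_nonneg (by positivity), le_div_iff₀ hK0]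
    exact hcon.le)
  exact absurd (h1.trans (le_iSup (fun n => G n x) n)) (not_le.2 hR)

/-- Riesz–Fischer: `L^Φ(μ)` is complete, for an arbitrary measure. -/
instance orliczSpace_completeSpace : CompleteSpace (orliczSpace Φ μ) := by
  refine NormedAddCommGroup.completeSpace_of_summable_imp_tendsto fun u hu => ?_
  let s : ℕ → orliczSpace Φ μ := fun n => ∑ i ∈ Finset.range n, u i
  have hlim : ∀ᵐ x ∂μ, Tendsto (fun n => (s n : X →ₘ[μ] ℝ) x) atTop
      (𝓝 (∑' i, (u i : X →ₘ[μ] ℝ) x)) := by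
    filter_upwards [ae_summable_abs_of_summable_norm hu,
      ae_all_iff.2 fun n => coeFn_orlicz_sum u (Finset.range n)] with x h1 h2
    simp only [s, h2]
    exact h1.of_abs.hasSum.tendsto_sum_nat
  let f : X →ₘ[μ] ℝ := AEEqFun.mk (fun x => ∑' i, (u i : X →ₘ[μ] ℝ) x)
    (aestronglyMeasurable_of_tendsto_ae atTop
      (fun n => (s n : X →ₘ[μ] ℝ).aestronglyMeasurable) hlim)
  have hf : ∀ᵐ x ∂μ, f x = ∑' i, (u i : X →ₘ[μ] ℝ) x := AEEqFun.coeFn_mk _ _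
  have hcau : CauchySeq s := cauchySeq_range_of_norm_bounded
    (hu.hasSum.tendsto_sum_nat.cauchySeq) fun i => le_rfl
  have htail : ∀ ε > 0, ∃ N, ∀ n ≥ N, ∃ hm : f - s n ∈ orliczSpace Φ μ,
      ‖(⟨f - s n, hm⟩ : orliczSpace Φ μ)‖ ≤ ε := by
    intro ε hε
    obtain ⟨N, hN⟩ := Metric.cauchySeq_iff.1 hcau ε hε
    refine ⟨N, fun n hn => exists_norm_le_of_ae_tendsto (h := fun m => s (N + m) - s n)
      (fun m => ?_) ?_⟩
    · rw [← dist_eq_norm]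
      exact (hN _ (Nat.le_add_right N m) n hn).le
    · filter_upwards [hlim, hf, AEEqFun.coeFn_sub f (s n),
        ae_all_iff.2 fun m => AEEqFun.coeFn_sub (s (N + m) : X →ₘ[μ] ℝ) (s n)] with x h1 h2 h3 h4
      simp only [Submodule.coe_sub, h4, h3, Pi.sub_apply, h2]
      refine Tendsto.sub_const ?_ _
      simpa only [add_comm N, Function.comp_def] using h1.comp (tendsto_add_atTop_nat N)
  have hfm : f ∈ orliczSpace Φ μ := by
    obtain ⟨N, hN⟩ := htail 1 one_pos
    obtain ⟨hm, -⟩ := hN N le_rfl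
    simpa using (orliczSpace Φ μ).add_mem hm (s N).2
  refine ⟨⟨f, hfm⟩, Metric.tendsto_atTop.2 fun ε hε => ?_⟩
  obtain ⟨N, hN⟩ := htail (ε / 2) (half_pos hε)
  refine ⟨N, fun n hn => ?_⟩
  obtain ⟨hm, h⟩ := hN n hn
  rw [dist_comm, dist_eq_norm]
  exact lt_of_le_of_lt h (half_lt_self hε)

end Modular

/-! ### Irregular vectors and Li-Yorke chaos -/

section LiYorke

variable {E : Type*} [NormedAddCommGroup E] [NormedSpace ℝ E]

/-- An irregular vector, that is, one whose orbit is unbounded and accumulates at `0`, makes the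
operator Li-Yorke chaotic: the line it spans is a scrambled set. -/
theorem liYorkeChaotic_of_irregular (T : E →L[ℝ] E) {x : E}
    (hinf : ∀ ε > 0, ∃ᶠ n in atTop, ‖T^[n] x‖ < ε) (hsup : ∀ C, ∃ n, C < ‖T^[n] x‖) :
    LiYorkeChaotic (T : E → E) := by
  have hx : x ≠ 0 := by
    rintro rfl
    obtain ⟨n, hn⟩ := hsup 0
    simp [iterate_map_zero] at hn
  have hinj : Function.Injective fun c : ℝ => c • x := smul_left_injective ℝ hx
  have hdist : ∀ (a b : ℝ) (n : ℕ),
      edist (T^[n] (a • x)) (T^[n] (b • x)) = ENNReal.ofReal (|a - b| * ‖T^[n] x‖) := by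
    intro a b n
    rw [edist_dist, dist_eq_norm, ← iterate_map_sub, ← sub_smul,
      ← FunLike.coe_pow_eq_iterate, map_smul, norm_smul, Real.norm_eq_abs]
  refine ⟨range fun c : ℝ => c • x, ?_, ?_⟩
  · intro hc
    have : (univ : Set ℝ).Countable := by
      rw [← image_univ] at hc
      exact countable_of_injective_of_countable_image hinj.injOn hc
    exact Cardinal.not_countable_real this
  rintro _ ⟨a, rfl⟩ _ ⟨b, rfl⟩ hab
  have hd : 0 < |a - b| := abs_pos.2 (sub_ne_zero.2 fun h => hab (by rw [h]))
  simp only [hdist]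
  constructor
  · refine le_antisymm (le_of_forall_gt_imp_ge_of_dense fun ε hε => ?_) bot_le
    obtain ⟨δ, hδ, hδε⟩ := ENNReal.lt_iff_exists_nnreal_btwn.1 hε
    have hδ0 : (0 : ℝ) < δ := by exact_mod_cast hδ
    refine liminf_le_of_frequently_le ((hinf (δ / |a - b|) (by positivity)).mono fun n hn => ?_)
      (by isBoundedDefault)
    refine le_trans ?_ hδε.le
    rw [← ENNReal.ofReal_coe_nnreal]
    refine ENNReal.ofReal_le_ofReal ?_
    rw [mul_comm]
    exact ((lt_div_iff₀ hd).1 hn).le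
  · refine zero_lt_one.trans_le (le_limsup_of_frequently_le ?_ (by isBoundedDefault))
    by_contra hcon
    rw [not_frequently] at hcon
    obtain ⟨N, hN⟩ := eventually_atTop.1 hcon
    obtain ⟨n, hn⟩ := hsup (1 / |a - b| + ∑ i ∈ Finset.range N, ‖T^[i] x‖)
    have h0 : 0 ≤ ∑ i ∈ Finset.range N, ‖T^[i] x‖ := Finset.sum_nonneg fun _ _ => norm_nonneg _
    rcases lt_or_ge n N with h | h
    · have := Finset.single_le_sum (f := fun i => ‖T^[i] x‖) (fun _ _ => norm_nonneg _)
        (Finset.mem_range.2 h)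
      have : 0 < 1 / |a - b| := by positivity
      linarith
    · refine hN n h ?_
      rw [← ENNReal.ofReal_one]
      refine ENNReal.ofReal_le_ofReal ?_
      rw [mul_comm]
      exact ((div_lt_iff₀ hd).1 (by linarith)).le

/-- A Li-Yorke chaos criterion. In the closed span of `A` the vectors with orbit accumulating at
`0` and the vectors with unbounded orbit both form dense `G_δ` sets, so by Baire's theorem some
vector is irregular. -/
theorem liYorkeChaotic_of_criterion [CompleteSpace E] (T : E →L[ℝ] E) (A : Set E) {β : ℕ → ℕ}
    (hβ : StrictMono β) (hA : ∀ a ∈ A, Tendsto (fun j => T^[β j] a) atTop (𝓝 0))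
    (hub : ∀ C : ℝ, ∃ a ∈ A, ∃ n, C * ‖a‖ < ‖T^[n] a‖) : LiYorkeChaotic (T : E → E) := by
  let Y : Submodule ℝ E := (Submodule.span ℝ A).topologicalClosure
  have hYc : IsClosed (Y : Set E) := Submodule.isClosed_topologicalClosure _
  have : CompleteSpace Y := hYc.completeSpace_coe
  have hAY : ∀ a ∈ A, a ∈ Y := fun a ha =>
    Submodule.le_topologicalClosure _ (Submodule.subset_span ha)
  have hspan : ∀ a ∈ Submodule.span ℝ A, Tendsto (fun j => T^[β j] a) atTop (𝓝 0) := by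
    intro a ha
    simp only [← FunLike.coe_pow_eq_iterate] at hA ⊢
    induction ha using Submodule.span_induction with
    | mem x hx => exact hA x hx
    | zero => simp
    | add x y _ _ hx hy => simpa using hx.add hy
    | smul c x _ hx => simpa using hx.const_smul c
  have hcont : ∀ n, Continuous fun y : Y => ‖T^[n] (y : E)‖ := fun n =>
    ((T.continuous.iterate n).comp continuous_subtype_val).norm
  let U : ℕ × ℕ → Set Y := fun p => {y | ∃ n ≥ p.1, ‖T^[n] (y : E)‖ < 1 / ((p.2 : ℝ) + 1)}
  let V : ℕ → Set Y := fun k => {y | ∃ n, (k : ℝ) < ‖T^[n] (y : E)‖}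
  have hUo : ∀ p, IsOpen (U p) := fun p => by
    have : U p = ⋃ n ≥ p.1, {y : Y | ‖T^[n] (y : E)‖ < 1 / ((p.2 : ℝ) + 1)} := by
      ext y; simp [U]
    rw [this]
    exact isOpen_biUnion fun n _ => isOpen_lt (hcont n) continuous_const
  have hVo : ∀ k, IsOpen (V k) := fun k => by
    have : V k = ⋃ n, {y : Y | (k : ℝ) < ‖T^[n] (y : E)‖} := by
      ext y; simp [V]
    rw [this]
    exact isOpen_iUnion fun n => isOpen_lt continuous_const (hcont n)
  have hUd : ∀ p, Dense (U p) := by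
    intro p
    refine Metric.dense_iff.2 fun y r hr => ?_
    obtain ⟨z, hz, hyz⟩ := Metric.mem_closure_iff.1
      (show (y : E) ∈ closure (Submodule.span ℝ A : Set E) from y.2) r hr
    refine ⟨⟨z, Submodule.le_topologicalClosure _ hz⟩, ?_, ?_⟩
    · rw [Metric.mem_ball, dist_comm]
      exact hyz
    · have h1 := (hspan z hz).norm
      rw [norm_zero] at h1
      obtain ⟨j, hj, hpj⟩ := ((h1.eventually (gt_mem_nhds
        (show (0 : ℝ) < 1 / ((p.2 : ℝ) + 1) by positivity))).and
          (eventually_ge_atTop p.1)).exists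
      exact ⟨β j, hpj.trans hβ.le_apply, hj⟩
  have hVd : ∀ k, Dense (V k) := by
    intro k
    refine Metric.dense_iff.2 fun y r hr => ?_
    obtain ⟨a, ha, n, hn⟩ := hub (2 * k / r)
    have ha0 : 0 < ‖a‖ := by
      refine norm_pos_iff.2 fun h => ?_
      simp [h, iterate_map_zero] at hn
    -- a short multiple of `a` whose image under `T^n` is long
    let w : Y := (r / 2 / ‖a‖) • ⟨a, hAY a ha⟩
    have hw : ‖w‖ < r := by
      rw [norm_smul, Real.norm_of_nonneg (by positivity)]
      change r / 2 / ‖a‖ * ‖a‖ < r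
      rw [div_mul_cancel₀ _ ha0.ne']
      linarith
    have hTw : (k : ℝ) < ‖T^[n] (w : E)‖ := by
      have : (w : E) = (r / 2 / ‖a‖) • a := rfl
      rw [this, ← FunLike.coe_pow_eq_iterate, map_smul, norm_smul,
        Real.norm_of_nonneg (by positivity), FunLike.coe_pow_eq_iterate]
      calc (k : ℝ) = r / 2 / ‖a‖ * (2 * k / r * ‖a‖) := by field_simp
        _ < _ := by gcongr
    have hsum : 2 * ‖T^[n] (w : E)‖ ≤ ‖T^[n] ((y + w : Y) : E)‖ + ‖T^[n] ((y - w : Y) : E)‖ := by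
      have h1 : T^[n] ((y + w : Y) : E) - T^[n] ((y - w : Y) : E) = (2 : ℝ) • T^[n] (w : E) := by
        rw [← iterate_map_sub, ← FunLike.coe_pow_eq_iterate, ← map_smul]
        congr 1
        simp only [Submodule.coe_add, Submodule.coe_sub, two_smul]
        abel
      have h2 := norm_sub_le (T^[n] ((y + w : Y) : E)) (T^[n] ((y - w : Y) : E))
      rwa [h1, norm_smul, Real.norm_of_nonneg zero_le_two] at h2
    rcases lt_or_ge (k : ℝ) ‖T^[n] ((y + w : Y) : E)‖ with h | h
    · exact ⟨y + w, by simpa [Metric.mem_ball, dist_eq_norm] using hw, n, h⟩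
    · exact ⟨y - w, by simpa [Metric.mem_ball, dist_eq_norm] using hw, n, by linarith⟩
  have hW : Dense (⋂ i : (ℕ × ℕ) ⊕ ℕ, Sum.elim U V i) :=
    dense_iInter_of_isOpen (by rintro (p | k); exacts [hUo p, hVo k])
      (by rintro (p | k); exacts [hUd p, hVd k])
  obtain ⟨y, hy⟩ := hW.nonempty
  rw [mem_iInter] at hy
  refine liYorkeChaotic_of_irregular T (x := y) (fun ε hε => ?_) fun C => ?_
  · obtain ⟨k, hk⟩ := exists_nat_one_div_lt hε
    refine frequently_atTop.2 fun N => ?_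
    obtain ⟨n, hn, h⟩ := hy (Sum.inl (N, k))
    exact ⟨n, hn, h.trans hk⟩
  · obtain ⟨k, hk⟩ := exists_nat_gt C
    obtain ⟨n, h⟩ := hy (Sum.inr k)
    exact ⟨n, hk.trans h⟩

end LiYorke

/-! ### The generalized inverse -/

namespace YoungFunction

theorem le_inv_of_apply_le (Φ : YoungFunction) {t : ℝ} (ht : 0 ≤ t) {y : ℝ≥0∞} (h : Φ t ≤ y) :
    ENNReal.ofReal t ≤ Φ.inv y := by
  refine le_iInf₂ fun x hx => ?_
  by_contra! hcon
  rw [ENNReal.coe_lt_ofReal] at hcon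
  refine absurd (lt_of_lt_of_le hx (Φ.mono ?_)) (not_lt.2 h)
  rw [abs_of_nonneg x.coe_nonneg, abs_of_nonneg ht]
  exact hcon.le

theorem apply_le_of_lt_inv (Φ : YoungFunction) {t : ℝ} (ht : 0 ≤ t) {y : ℝ≥0∞}
    (h : ENNReal.ofReal t < Φ.inv y) : Φ t ≤ y := by
  by_contra! hcon
  refine absurd h (not_lt.2 (iInf₂_le t.toNNReal ?_))
  rwa [Real.coe_toNNReal _ ht]

theorem le_apply_of_inv_lt (Φ : YoungFunction) {t : ℝ} {y : ℝ≥0∞}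
    (h : Φ.inv y < ENNReal.ofReal t) : y ≤ Φ t := by
  rcases le_total 0 t with ht | ht
  · by_contra! hcon
    exact absurd h (not_lt.2 (Φ.le_inv_of_apply_le ht hcon.le))
  · simp [ENNReal.ofReal_of_nonpos ht] at h

theorem inv_lt_top (Φ : YoungFunction) {y : ℝ≥0∞} (hy : y < ⊤) : Φ.inv y < ⊤ := by
  obtain ⟨R, hR, hR0⟩ := ((Φ.tendsto'.eventually (lt_mem_nhds hy)).and
    (eventually_ge_atTop 0)).exists
  refine lt_of_le_of_lt (iInf₂_le R.toNNReal ?_) ENNReal.coe_lt_top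
  rwa [Real.coe_toNNReal _ hR0]

end YoungFunction

theorem le_one_div_iff_mul_le_one {a b : ℝ≥0∞} : a ≤ 1 / b ↔ a * b ≤ 1 :=
  ENNReal.le_div_iff_mul_le (.inr one_ne_zero) (.inr ENNReal.one_ne_top)

/-! ### Characteristic functions under the composition operator -/

section CompositionOperator

variable {X : Type*} [MeasurableSpace X] {μ : Measure X} {Φ : YoungFunction}

/-- The norm of a characteristic function is `1 / Φ⁻¹(1 / μ(F))`. -/
theorem ofReal_norm_indicator {f : orliczSpace Φ μ} {F : Set X} (hF : MeasurableSet F)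
    (hf : (f : X →ₘ[μ] ℝ) =ᵐ[μ] F.indicator 1) :
    ENNReal.ofReal ‖f‖ = (Φ.inv (1 / μ F))⁻¹ := by
  have hint : ∀ k : ℝ, ∫⁻ x, Φ ((f : X →ₘ[μ] ℝ) x / k) ∂μ = Φ (1 / k) * μ F := by
    intro k
    rw [← lintegral_indicator_const hF]
    refine lintegral_congr_ae ?_
    filter_upwards [hf] with x hx
    rw [hx]
    by_cases hxF : x ∈ F <;> simp [hxF, Φ.zero']
  refine le_antisymm (le_of_forall_gt_imp_ge_of_dense fun c hc => ?_)
    (le_of_forall_gt_imp_ge_of_dense fun c hc => ?_)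
  · induction c with
    | top => exact le_top
    | coe k =>
      have hk : (0 : ℝ) < k := by exact_mod_cast zero_le.trans_lt hc
      rw [← ENNReal.ofReal_coe_nnreal] at hc ⊢
      refine ENNReal.ofReal_le_ofReal (norm_le_of_lintegral_le_one f hk ?_)
      rw [hint, ← le_one_div_iff_mul_le_one]
      refine Φ.apply_le_of_lt_inv (by positivity) ?_
      rw [one_div, ENNReal.ofReal_inv_of_pos hk]
      exact ENNReal.inv_lt_iff_inv_lt.1 hc
  · induction c with
    | top => exact le_top
    | coe k =>
      have hk : (0 : ℝ) < k := by exact_mod_cast zero_le.trans_lt hc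
      rw [← ENNReal.ofReal_coe_nnreal] at hc ⊢
      have h := lintegral_le_one_of_norm_lt f ((ENNReal.ofReal_lt_ofReal_iff hk).1 hc)
      rw [hint, ← le_one_div_iff_mul_le_one] at h
      have h2 := Φ.le_inv_of_apply_le (by positivity) h
      rw [one_div, ENNReal.ofReal_inv_of_pos hk] at h2
      exact ENNReal.inv_le_iff_inv_le.1 h2

variable {φ : X → X} {hφ : Measure.QuasiMeasurePreserving φ μ μ}
  {hmaps : ∀ f ∈ orliczSpace Φ μ, f.compQuasiMeasurePreserving φ hφ ∈ orliczSpace Φ μ}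

theorem coeFn_compositionOperator (f : orliczSpace Φ μ) :
    (compositionOperator Φ μ φ hφ hmaps f : X →ₘ[μ] ℝ) =ᵐ[μ] (f : X →ₘ[μ] ℝ) ∘ φ :=
  AEEqFun.coeFn_compQuasiMeasurePreserving _ hφ

theorem coeFn_iterate_compositionOperator (f : orliczSpace Φ μ) (n : ℕ) :
    ((compositionOperator Φ μ φ hφ hmaps)^[n] f : X →ₘ[μ] ℝ)
      =ᵐ[μ] (f : X →ₘ[μ] ℝ) ∘ φ^[n] := by
  induction n with
  | zero => exact ae_eq_refl _
  | succ n ih =>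
    rw [Function.iterate_succ_apply', Function.iterate_succ, ← Function.comp_assoc]
    exact (coeFn_compositionOperator _).trans (hφ.ae_eq_comp ih)

/-- A continuous composition operator, bundled as a continuous linear map. -/
noncomputable def compositionCLM (hcont : Continuous (compositionOperator Φ μ φ hφ hmaps)) :
    orliczSpace Φ μ →L[ℝ] orliczSpace Φ μ where
  toFun := compositionOperator Φ μ φ hφ hmaps
  map_add' f g := by
    refine Subtype.ext (AEEqFun.ext ?_)
    filter_upwards [coeFn_compositionOperator (hmaps := hmaps) (f + g),
      coeFn_compositionOperator (hmaps := hmaps) f, coeFn_compositionOperator (hmaps := hmaps) g,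
      AEEqFun.coeFn_add (compositionOperator Φ μ φ hφ hmaps f : X →ₘ[μ] ℝ)
        (compositionOperator Φ μ φ hφ hmaps g),
      hφ.ae_eq_comp (AEEqFun.coeFn_add (f : X →ₘ[μ] ℝ) g)] with x h1 h2 h3 h4 h5
    rw [Submodule.coe_add, h1, h4, Pi.add_apply, h2, h3]
    exact h5
  map_smul' c f := by
    refine Subtype.ext (AEEqFun.ext ?_)
    filter_upwards [coeFn_compositionOperator (hmaps := hmaps) (c • f),
      coeFn_compositionOperator (hmaps := hmaps) f,
      AEEqFun.coeFn_smul c (compositionOperator Φ μ φ hφ hmaps f : X →ₘ[μ] ℝ),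
      hφ.ae_eq_comp (AEEqFun.coeFn_smul c (f : X →ₘ[μ] ℝ))] with x h1 h2 h3 h4
    rw [RingHom.id_apply, Submodule.coe_smul, h1, h3, Pi.smul_apply, h2]
    exact h4
  cont := hcont

theorem exists_orlicz_indicator {x : ℝ} (hx : 0 < x) (hΦ : Φ x < ⊤) {F : Set X}
    (hF : MeasurableSet F) (hμ : μ F < ⊤) :
    ∃ f : orliczSpace Φ μ, (f : X →ₘ[μ] ℝ) =ᵐ[μ] F.indicator 1 := by
  have hm : AEStronglyMeasurable (F.indicator (1 : X → ℝ)) μ :=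
    (stronglyMeasurable_one.indicator hF).aestronglyMeasurable
  refine ⟨⟨AEEqFun.mk _ hm, x, hx, ?_⟩, AEEqFun.coeFn_mk _ hm⟩
  calc ∫⁻ y, Φ (x * AEEqFun.mk (F.indicator (1 : X → ℝ)) hm y) ∂μ
      = ∫⁻ y, F.indicator (fun _ => Φ x) y ∂μ := by
        refine lintegral_congr_ae ?_
        filter_upwards [AEEqFun.coeFn_mk _ hm] with y hy
        rw [hy]
        by_cases hyF : y ∈ F <;> simp [hyF, Φ.zero']
    _ = Φ x * μ F := lintegral_indicator_const hF _
    _ < ⊤ := ENNReal.mul_lt_top hΦ hμ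

theorem ofReal_norm_iterate_indicator {f : orliczSpace Φ μ} {F : Set X} (hF : MeasurableSet F)
    (hf : (f : X →ₘ[μ] ℝ) =ᵐ[μ] F.indicator 1) (n : ℕ) :
    ENNReal.ofReal ‖(compositionOperator Φ μ φ hφ hmaps)^[n] f‖
      = (Φ.inv (1 / μ (φ^[n] ⁻¹' F)))⁻¹ := by
  refine ofReal_norm_indicator ((hφ.iterate n).measurable hF)
    ((coeFn_iterate_compositionOperator f n).trans ?_)
  exact (hφ.iterate n).ae_eq_comp hf

theorem liYorkeChaotic_of_setCondition
    (hcont : Continuous (compositionOperator Φ μ φ hφ hmaps)) (h : SetCondition Φ μ φ) :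
    LiYorkeChaotic (compositionOperator Φ μ φ hφ hmaps) := by
  obtain ⟨S, β, -, -, hS, hβ, hI, hII⟩ := h
  have hlt : ∀ c : ℝ≥0∞, c < ⊤ → ∃ F ∈ S, ∃ n : ℕ,
      c < Φ.inv (1 / μ F) / Φ.inv (1 / μ (φ^[n] ⁻¹' F)) := by
    intro c hc
    rw [← hII] at hc
    simpa only [lt_iSup_iff, exists_prop] using hc
  have hfin : ∀ F ∈ S, 1 / μ F < ⊤ := fun F hF =>
    ENNReal.div_lt_top ENNReal.one_ne_top (hS F hF).2.1.ne'
  -- an infinite supremum rules out the `Φ` that is infinite off `0`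
  obtain ⟨x, hx, hΦx⟩ : ∃ x : ℝ, 0 < x ∧ Φ x < ⊤ := by
    obtain ⟨F, hF, n, hn⟩ := hlt 0 ENNReal.zero_lt_top
    have h0 : 0 < Φ.inv (1 / μ F) := by
      refine pos_iff_ne_zero.2 fun h0 => ?_
      rw [h0, ENNReal.zero_div] at hn
      exact lt_irrefl _ hn
    obtain ⟨t, ht0, ht⟩ := ENNReal.lt_iff_exists_nnreal_btwn.1 h0
    refine ⟨t, by exact_mod_cast ht0,
      (Φ.apply_le_of_lt_inv t.coe_nonneg ?_).trans_lt (hfin F hF)⟩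
    rwa [ENNReal.ofReal_coe_nnreal]
  have hT : ∀ n, (compositionCLM hcont)^[n] = (compositionOperator Φ μ φ hφ hmaps)^[n] :=
    fun _ => rfl
  refine liYorkeChaotic_of_criterion (compositionCLM hcont)
    {f | ∃ F ∈ S, (f : X →ₘ[μ] ℝ) =ᵐ[μ] F.indicator 1} hβ ?_ fun C => ?_
  · rintro f ⟨F, hF, hf⟩
    have h1 := tendsto_inv_iff.2 (hI F hF)
    simp only [← ofReal_norm_iterate_indicator (hmaps := hmaps) (hS F hF).1 hf,
      ENNReal.inv_top] at h1
    refine tendsto_zero_iff_norm_tendsto_zero.2 ?_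
    have h2 := (ENNReal.tendsto_toReal ENNReal.zero_ne_top).comp h1
    simpa only [Function.comp_def, ENNReal.toReal_ofReal (norm_nonneg _),
      ENNReal.toReal_zero, hT] using h2
  · obtain ⟨F, hF, n, hn⟩ := hlt (ENNReal.ofReal C) ENNReal.ofReal_lt_top
    obtain ⟨f, hf⟩ := exists_orlicz_indicator hx hΦx (hS F hF).1 (hS F hF).2.2
    refine ⟨f, ⟨F, hF, hf⟩, n, ?_⟩
    have h0 := ofReal_norm_indicator (hS F hF).1 hf
    have hpos : 0 < ‖f‖ := by
      rw [← ENNReal.ofReal_pos, h0, ENNReal.inv_pos]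
      exact (Φ.inv_lt_top (hfin F hF)).ne
    rw [div_eq_mul_inv, ← ofReal_norm_iterate_indicator (hmaps := hmaps) (hS F hF).1 hf,
      ← inv_inv (Φ.inv (1 / μ F)), ← h0, ← ENNReal.ofReal_inv_of_pos hpos,
      ← ENNReal.ofReal_mul (by positivity)] at hn
    have h2 := (ENNReal.ofReal_lt_ofReal_iff'.1 hn).1
    rw [inv_mul_eq_div, lt_div_iff₀ hpos] at h2
    exact h2

end CompositionOperator

/-! ### Consequences of the global Δ₂-condition -/

namespace YoungFunction

theorem exists_pos_apply_le (Φ : YoungFunction) {x : ℝ} (hx : 0 < x) (hΦ : Φ x < ⊤) {y : ℝ≥0∞}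
    (hy : 0 < y) : ∃ t : ℝ, 0 < t ∧ Φ t ≤ y := by
  induction y with
  | top => exact ⟨x, hx, le_top⟩
  | coe y =>
    have hy' : (0 : ℝ) < y := by exact_mod_cast hy
    obtain ⟨c, hc⟩ : ∃ c : ℝ≥0, (c : ℝ≥0∞) = Φ x := ⟨_, ENNReal.coe_toNNReal hΦ.ne⟩
    have ha : 0 < min 1 ((y : ℝ) / (c + 1)) := lt_min one_pos (div_pos hy' (by positivity))
    refine ⟨min 1 ((y : ℝ) / (c + 1)) * x, mul_pos ha hx,
      (Φ.mul_le ha.le (min_le_left _ _) x).trans ?_⟩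
    rw [← hc, ← ENNReal.ofReal_coe_nnreal (p := c), ← ENNReal.ofReal_mul ha.le,
      ← ENNReal.ofReal_coe_nnreal (p := y)]
    refine ENNReal.ofReal_le_ofReal ?_
    calc min 1 ((y : ℝ) / (c + 1)) * c ≤ y / (c + 1) * (c + 1) := by
          gcongr
          · exact min_le_right _ _
          · linarith
      _ = y := by field_simp

section Delta2

variable {Φ : YoungFunction} {K : ℝ≥0}

theorem apply_two_pow_mul_le (hK : ∀ x : ℝ, 0 ≤ x → Φ (2 * x) ≤ (K : ℝ≥0∞) * Φ x) (p : ℕ)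
    (x : ℝ) : Φ (2 ^ p * x) ≤ (K : ℝ≥0∞) ^ p * Φ x := by
  induction p with
  | zero => simp
  | succ p ih =>
    calc Φ (2 ^ (p + 1) * x) = Φ (2 * |2 ^ p * x|) := by
          rw [← Φ.apply_abs, pow_succ', mul_assoc, abs_mul, abs_two]
      _ ≤ K * Φ |2 ^ p * x| := hK _ (abs_nonneg _)
      _ ≤ K * ((K : ℝ≥0∞) ^ p * Φ x) := by
          rw [Φ.apply_abs]
          gcongr
      _ = (K : ℝ≥0∞) ^ (p + 1) * Φ x := by ring

theorem exists_abs_le_two_pow_mul {x y : ℝ} (hy : y ≠ 0) : ∃ p : ℕ, |x| ≤ |2 ^ p * y| := by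
  obtain ⟨p, hp⟩ := pow_unbounded_of_one_lt (|x| / |y|) one_lt_two
  refine ⟨p, ?_⟩
  rw [abs_mul, abs_of_pos (show (0 : ℝ) < 2 ^ p by positivity)]
  exact ((div_lt_iff₀ (abs_pos.2 hy)).1 hp).le

/-- Under `Δ₂`, a zero of `Φ` off `0` would make `Φ` vanish identically. -/
theorem apply_pos_of_delta2 (hK : ∀ x : ℝ, 0 ≤ x → Φ (2 * x) ≤ (K : ℝ≥0∞) * Φ x) {x : ℝ}
    (hx : x ≠ 0) : 0 < Φ x := by
  refine pos_iff_ne_zero.2 fun h0 => ?_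
  obtain ⟨R, hR⟩ := (Φ.tendsto'.eventually (lt_mem_nhds ENNReal.zero_lt_top)).exists
  obtain ⟨p, hp⟩ := exists_abs_le_two_pow_mul (x := R) hx
  have := (Φ.mono hp).trans (apply_two_pow_mul_le hK p x)
  rw [h0, mul_zero] at this
  exact absurd hR (not_lt.2 this)

/-- Under `Δ₂`, a bound on the ratio of norms of characteristic functions is a bound on the ratio
of the measures. -/
theorem measure_le_of_inv_le (hK : ∀ x : ℝ, 0 ≤ x → Φ (2 * x) ≤ (K : ℝ≥0∞) * Φ x) {x : ℝ}
    (hx : 0 < x) (hΦ : Φ x < ⊤) {p : ℕ} {a b : ℝ≥0∞} (ha0 : a ≠ 0) (ha : a ≠ ⊤)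
    (h : Φ.inv (1 / a) ≤ 2 ^ p * Φ.inv (1 / b)) : b ≤ (K : ℝ≥0∞) ^ (p + 2) * a := by
  have hfin : Φ.inv (1 / a) ≠ ⊤ := (Φ.inv_lt_top (ENNReal.div_lt_top ENNReal.one_ne_top ha0)).ne
  obtain ⟨t, ht0, ht⟩ := Φ.exists_pos_apply_le hx hΦ (y := 1 / a) (by simpa using ha)
  set r : ℝ := (Φ.inv (1 / a)).toReal with hr
  have hr' : ENNReal.ofReal r = Φ.inv (1 / a) := ENNReal.ofReal_toReal hfin
  have hr0 : 0 < r := by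
    rw [← ENNReal.ofReal_pos, hr']
    exact (ENNReal.ofReal_pos.2 ht0).trans_le (Φ.le_inv_of_apply_le ht0.le ht)
  have h1 : 1 / a ≤ Φ (2 * r) := Φ.le_apply_of_inv_lt (by
    rw [← hr']
    exact (ENNReal.ofReal_lt_ofReal_iff (by positivity)).2 (by linarith))
  have h2 : Φ (r / 2 ^ (p + 1)) ≤ 1 / b := by
    refine Φ.apply_le_of_lt_inv (by positivity) ?_
    by_contra! hcon
    have h3 : Φ.inv (1 / a) ≤ ENNReal.ofReal (2 ^ p * (r / 2 ^ (p + 1))) := by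
      rw [ENNReal.ofReal_mul (by positivity), ENNReal.ofReal_pow zero_le_two, ENNReal.ofReal_ofNat]
      exact h.trans (by gcongr)
    rw [← hr', ENNReal.ofReal_le_ofReal_iff (by positivity)] at h3
    have h4 : (2 : ℝ) ^ p * (r / 2 ^ (p + 1)) = r / 2 := by
      rw [pow_succ]; field_simp
    linarith
  -- `1 / a ≤ Φ (2 * r)` and `Φ (r / 2 ^ (p + 1)) ≤ 1 / b`: both arguments keep a factor `2` away
  -- from the value of the inverse, so that nothing about `Φ` at that value is needed.
  have h5 : 1 / a ≤ (K : ℝ≥0∞) ^ (p + 2) * (1 / b) := by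
    calc 1 / a ≤ Φ (2 * r) := h1
      _ = Φ (2 ^ (p + 2) * (r / 2 ^ (p + 1))) := by
        congr 1
        rw [pow_succ 2 (p + 1)]; field_simp
      _ ≤ (K : ℝ≥0∞) ^ (p + 2) * Φ (r / 2 ^ (p + 1)) := apply_two_pow_mul_le hK _ _
      _ ≤ _ := by gcongr
  rw [ENNReal.div_le_iff ha0 ha] at h5
  calc b = b * 1 := (mul_one b).symm
    _ ≤ b * ((K : ℝ≥0∞) ^ (p + 2) * (1 / b) * a) := by gcongr
    _ = (K : ℝ≥0∞) ^ (p + 2) * a * (b⁻¹ * b) := by rw [one_div]; ring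
    _ ≤ (K : ℝ≥0∞) ^ (p + 2) * a * 1 := by gcongr; exact ENNReal.inv_mul_le_one b
    _ = _ := mul_one _

end Delta2

end YoungFunction

/-- The dyadic level sets `{2 ^ k < |f| ≤ 2 ^ (k + 1)}`, `k ∈ ℤ`, which partition `{f ≠ 0}`. -/
def dyadicLevel {X : Type*} (f : X → ℝ) (k : ℤ) : Set X :=
  {x | |f x| ∈ Ioc ((2 : ℝ) ^ k) (2 ^ (k + 1))}

/-! ### Dyadic level sets -/

section DyadicLevel

variable {X : Type*} {f : X → ℝ}

theorem exists_mem_dyadicLevel {x : X} (hx : f x ≠ 0) : ∃ k, x ∈ dyadicLevel f k :=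
  exists_mem_Ioc_zpow (abs_pos.2 hx) one_lt_two

theorem eq_of_mem_dyadicLevel {x : X} {k l : ℤ} (hk : x ∈ dyadicLevel f k)
    (hl : x ∈ dyadicLevel f l) : k = l := by
  have h1 := (zpow_lt_zpow_iff_right₀ (one_lt_two (α := ℝ))).1 (hk.1.trans_le hl.2)
  have h2 := (zpow_lt_zpow_iff_right₀ (one_lt_two (α := ℝ))).1 (hl.1.trans_le hk.2)
  lia

theorem notMem_dyadicLevel {x : X} (hx : f x = 0) (k : ℤ) : x ∉ dyadicLevel f k := fun h => by
  have h1 := h.1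
  rw [hx, abs_zero] at h1
  exact absurd h1 (not_lt.2 (by positivity))

theorem measurableSet_dyadicLevel [MeasurableSpace X] (hf : Measurable f) (k : ℤ) :
    MeasurableSet (dyadicLevel f k) :=
  hf.abs measurableSet_Ioc

/-- Under `Δ₂`, the modular `∫ Φ(f)` is comparable to
`∑ₖ Φ(2 ^ (k + 1)) μ{2 ^ k < |f| ≤ 2 ^ (k + 1)}`, so that a comparison of two
measures on the dyadic level sets of `f` passes to the modular. -/
theorem lintegral_young_le_of_dyadicLevel [MeasurableSpace X] {Φ : YoungFunction} {K : ℝ≥0}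
    (hK : ∀ x : ℝ, 0 ≤ x → Φ (2 * x) ≤ (K : ℝ≥0∞) * Φ x) (hf : Measurable f) {ν ρ : Measure X}
    {M : ℝ≥0∞} (h : ∀ k, ν (dyadicLevel f k) ≤ M * ρ (dyadicLevel f k)) :
    ∫⁻ x, Φ (f x) ∂ν ≤ M * (K * ∫⁻ x, Φ (f x) ∂ρ) := by
  let g : ℤ → X → ℝ≥0∞ := fun k => (dyadicLevel f k).indicator fun _ => Φ (2 ^ (k + 1))
  have hg : ∀ k, Measurable (g k) := fun k =>
    measurable_const.indicator (measurableSet_dyadicLevel hf k)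
  have hint : ∀ m : Measure X,
      ∫⁻ x, ∑' k, g k x ∂m = ∑' k, Φ (2 ^ (k + 1)) * m (dyadicLevel f k) := fun m => by
    rw [lintegral_tsum fun k => (hg k).aemeasurable]
    exact tsum_congr fun k => lintegral_indicator_const (measurableSet_dyadicLevel hf k) _
  have hval : ∀ {x k}, x ∈ dyadicLevel f k → ∑' l, g l x = Φ (2 ^ (k + 1)) := fun {x k} hk => by
    rw [tsum_eq_single k fun l hl =>
      indicator_of_notMem (fun hmem => hl (eq_of_mem_dyadicLevel hmem hk)) _]
    exact indicator_of_mem hk _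
  have hlow : ∀ x, Φ (f x) ≤ ∑' k, g k x := fun x => by
    by_cases hx : f x = 0
    · simp [hx, Φ.zero']
    obtain ⟨k, hk⟩ := exists_mem_dyadicLevel hx
    rw [hval hk]
    exact Φ.mono (hk.2.trans (le_abs_self _))
  have hup : ∀ x, ∑' k, g k x ≤ K * Φ (f x) := fun x => by
    by_cases hx : f x = 0
    · have : ∀ k, g k x = 0 := fun k => indicator_of_notMem (notMem_dyadicLevel hx k) _
      simp [this]
    obtain ⟨k, hk⟩ := exists_mem_dyadicLevel hx
    rw [hval hk, zpow_add_one₀ two_ne_zero, mul_comm]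
    refine (hK _ (by positivity)).trans ?_
    gcongr
    refine Φ.mono ?_
    rw [abs_of_pos (by positivity)]
    exact hk.1.le
  calc ∫⁻ x, Φ (f x) ∂ν ≤ ∫⁻ x, ∑' k, g k x ∂ν := lintegral_mono hlow
    _ = ∑' k, Φ (2 ^ (k + 1)) * ν (dyadicLevel f k) := hint ν
    _ ≤ ∑' k, M * (Φ (2 ^ (k + 1)) * ρ (dyadicLevel f k)) := by
        refine ENNReal.tsum_le_tsum fun k => ?_
        rw [mul_left_comm]
        gcongr
        exact h k
    _ = M * ∫⁻ x, ∑' k, g k x ∂ρ := by rw [ENNReal.tsum_mul_left, hint ρ]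
    _ ≤ M * ∫⁻ x, K * Φ (f x) ∂ρ := by gcongr with x; exact hup x
    _ = M * (K * ∫⁻ x, Φ (f x) ∂ρ) := by rw [lintegral_const_mul' _ _ ENNReal.coe_ne_top]

end DyadicLevel

/-! ### From Li-Yorke chaos to the set condition -/

section Converse

variable {X : Type*} [MeasurableSpace X] {μ : Measure X} {Φ : YoungFunction}

/-- Markov's inequality for the gauge norm. -/
theorem apply_mul_measure_le_one {g : orliczSpace Φ μ} {G : Set X} (hG : MeasurableSet G)
    {c k : ℝ} (hc : 0 ≤ c) (hcG : ∀ᵐ x ∂μ, x ∈ G → c ≤ |(g : X →ₘ[μ] ℝ) x|) (hk : ‖g‖ < k) :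
    Φ (c / k) * μ G ≤ 1 := by
  have hk0 : 0 < k := (norm_nonneg g).trans_lt hk
  rw [← lintegral_indicator_const hG]
  refine (lintegral_mono_ae ?_).trans (lintegral_le_one_of_norm_lt g hk)
  filter_upwards [hcG] with x hx
  by_cases hxG : x ∈ G
  · rw [indicator_of_mem hxG]
    refine Φ.mono ?_
    rw [abs_div, abs_div, abs_of_nonneg hc]
    gcongr
    exact hx hxG
  · simp [hxG]

/-- If `Φ` is infinite off `0`, then `L^Φ(μ)` is trivial. This `Φ` satisfies `Δ₂` and has to be
excluded separately. -/
theorem exists_pos_apply_lt_top {f : orliczSpace Φ μ} (hf : f ≠ 0) :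
    ∃ x : ℝ, 0 < x ∧ Φ x < ⊤ := by
  obtain ⟨k, hk, hfk⟩ := f.2
  have h1 := ae_lt_top' (Φ.measurable.comp_aemeasurable
    ((f : X →ₘ[μ] ℝ).aemeasurable.const_mul k)) hfk.ne
  have h2 : ∃ᵐ x ∂μ, (f : X →ₘ[μ] ℝ) x ≠ 0 := fun hcon => hf <| by
    refine Subtype.ext (AEEqFun.ext ?_)
    filter_upwards [hcon, AEEqFun.coeFn_zero (α := X) (β := ℝ) (μ := μ)] with x hx hx0
    exact (not_not.1 hx).trans hx0.symm
  obtain ⟨x, hx, hx'⟩ := (h2.and_eventually h1).exists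
  refine ⟨|k * (f : X →ₘ[μ] ℝ) x|, abs_pos.2 (mul_ne_zero hk.ne' hx), ?_⟩
  rw [Φ.apply_abs]
  exact hx'

variable {φ : X → X} {hφ : Measure.QuasiMeasurePreserving φ μ μ}
  {hmaps : ∀ f ∈ orliczSpace Φ μ, f.compQuasiMeasurePreserving φ hφ ∈ orliczSpace Φ μ}

theorem setCondition_of_liYorkeChaotic
    (hcont : Continuous (compositionOperator Φ μ φ hφ hmaps)) (hΔ : Φ.GlobalDelta2)
    (h : LiYorkeChaotic (compositionOperator Φ μ φ hφ hmaps)) : SetCondition Φ μ φ := by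
  obtain ⟨K, -, hK⟩ := hΔ
  obtain ⟨S, hS, hpair⟩ := h
  obtain ⟨u, hu, v, hv, huv⟩ : ∃ u ∈ S, ∃ v ∈ S, u ≠ v := by
    by_contra! hcon
    exact hS (Set.Subsingleton.countable fun u hu v hv => hcon u hu v hv)
  obtain ⟨hinf, hsup⟩ := hpair u hu v hv huv
  set T := compositionOperator Φ μ φ hφ hmaps
  set f : orliczSpace Φ μ := u - v with hf
  have hf0 : f ≠ 0 := sub_ne_zero.2 huv
  have hdist : ∀ n, edist (T^[n] u) (T^[n] v) = ENNReal.ofReal ‖T^[n] f‖ := fun n => by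
    rw [edist_dist, dist_eq_norm, hf]
    congr 2
    exact (iterate_map_sub (compositionCLM hcont) n u v).symm
  simp only [hdist] at hinf hsup
  have hfreq : ∀ ε > 0, ∃ᶠ n in atTop, ‖T^[n] f‖ < ε := fun ε hε =>
    (frequently_lt_of_liminf_lt (by isBoundedDefault)
      (hinf.trans_lt (ENNReal.ofReal_pos.2 hε))).mono fun n hn =>
        (ENNReal.ofReal_lt_ofReal_iff hε).1 hn
  obtain ⟨β, hβ, hβf⟩ := extraction_forall_of_frequently fun j : ℕ =>
    hfreq (1 / ((j : ℝ) + 1)) (by positivity)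
  have hβ0 : Tendsto (fun j => T^[β j] f) atTop (𝓝 0) :=
    tendsto_zero_iff_norm_tendsto_zero.2 (squeeze_zero (fun _ => norm_nonneg _)
      (fun j => (hβf j).le) tendsto_one_div_add_atTop_nhds_zero_nat)
  obtain ⟨x₀, hx₀, hΦx₀⟩ := exists_pos_apply_lt_top hf0
  let F : ℤ → Set X := dyadicLevel (f : X →ₘ[μ] ℝ)
  have hfm : Measurable (f : X →ₘ[μ] ℝ) := (f : X →ₘ[μ] ℝ).stronglyMeasurable.measurable
  have hFm : ∀ n k, MeasurableSet (φ^[n] ⁻¹' F k) := fun n k =>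
    (hφ.iterate n).measurable (measurableSet_dyadicLevel hfm k)
  have hmark : ∀ n k (r : ℝ), ‖T^[n] f‖ < r → Φ (2 ^ k / r) * μ (φ^[n] ⁻¹' F k) ≤ 1 := by
    intro n k r hr
    refine apply_mul_measure_le_one (hFm n k) (by positivity) ?_ hr
    filter_upwards [coeFn_iterate_compositionOperator (hmaps := hmaps) f n] with x hx hxF
    rw [hx]
    exact (hxF : φ^[n] x ∈ F k).1.le
  have hfin : ∀ n k, μ (φ^[n] ⁻¹' F k) < ⊤ := by
    intro n k
    refine lt_top_iff_ne_top.2 fun htop => ?_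
    have h1 := hmark n k (‖T^[n] f‖ + 1) (by linarith)
    rw [htop, ENNReal.mul_top (YoungFunction.apply_pos_of_delta2 hK (by positivity)).ne'] at h1
    exact absurd h1 (by simp)
  -- All preimages of the level sets of `f` are included, since the bound on ratios is applied to
  -- `T^m f` for every `m`.
  refine ⟨{G | 0 < μ G ∧ ∃ m k, G = φ^[m] ⁻¹' F k}, β, ?_, ?_, ?_, hβ, ?_, ?_⟩
  · by_contra hempty
    rw [Set.not_nonempty_iff_eq_empty, Set.eq_empty_iff_forall_notMem] at hempty
    refine hf0 (Subtype.ext (AEEqFun.ext ?_))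
    have hnull : ∀ k, ∀ᵐ x ∂μ, x ∉ F k := fun k => by
      refine measure_eq_zero_iff_ae_notMem.1 ?_
      by_contra hne
      exact hempty (F k) ⟨pos_iff_ne_zero.2 hne, 0, k, rfl⟩
    filter_upwards [ae_all_iff.2 hnull, AEEqFun.coeFn_zero (α := X) (β := ℝ) (μ := μ)]
      with x hx hx0
    refine Eq.trans ?_ hx0.symm
    by_contra hne
    obtain ⟨k, hk⟩ := exists_mem_dyadicLevel hne
    exact hx k hk
  · refine (countable_range fun p : ℕ × ℤ => φ^[p.1] ⁻¹' F p.2).mono ?_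
    rintro _ ⟨-, m, k, rfl⟩
    exact ⟨(m, k), rfl⟩
  · rintro _ ⟨hpos, m, k, rfl⟩
    exact ⟨hFm m k, hpos, hfin m k⟩
  · rintro _ ⟨-, m, k, rfl⟩
    have hlim : Tendsto (fun j => ‖T^[m + β j] f‖) atTop (𝓝 0) := by
      have h1 := ((hcont.iterate m).tendsto 0).comp hβ0
      have h2 : T^[m] 0 = 0 := iterate_map_zero (compositionCLM hcont) m
      rw [h2] at h1
      simpa only [Function.comp_def, ← Function.iterate_add_apply, norm_zero] using h1.norm
    refine ENNReal.tendsto_nhds_top_iff_nnreal.2 fun R => ?_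
    have hr : (0 : ℝ) < 2 ^ k / (R + 1) := by positivity
    filter_upwards [hlim.eventually (gt_mem_nhds hr)] with j hj
    have h1 := hmark _ k _ hj
    rw [div_div_cancel₀ (by positivity), ← le_one_div_iff_mul_le_one] at h1
    rw [← preimage_comp, ← Function.iterate_add]
    refine lt_of_lt_of_le ?_ (Φ.le_inv_of_apply_le (by positivity) h1)
    rw [ENNReal.coe_lt_ofReal]
    linarith
  · by_contra hne
    obtain ⟨B, hB⟩ : ∃ B : ℝ≥0, (B : ℝ≥0∞) = _ := ⟨_, ENNReal.coe_toNNReal hne⟩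
    obtain ⟨p, hp⟩ := pow_unbounded_of_one_lt B one_lt_two
    set M : ℝ≥0 := K ^ (p + 2) with hM
    have hmeas : ∀ m n k, μ (φ^[m + n] ⁻¹' F k) ≤ M * μ (φ^[m] ⁻¹' F k) := by
      intro m n k
      rw [Function.iterate_add, preimage_comp]
      rcases eq_or_ne (μ (φ^[m] ⁻¹' F k)) 0 with h0 | h0
      · rw [(hφ.iterate n).preimage_null h0]
        exact zero_le
      · rw [hM, ENNReal.coe_pow]
        refine YoungFunction.measure_le_of_inv_le hK hx₀ hΦx₀ h0 (hfin m k).ne ?_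
        have hle : Φ.inv (1 / μ (φ^[m] ⁻¹' F k)) / Φ.inv (1 / μ (φ^[n] ⁻¹' (φ^[m] ⁻¹' F k)))
            ≤ B := by
          rw [hB]
          exact le_iSup₂_of_le (φ^[m] ⁻¹' F k) ⟨pos_iff_ne_zero.2 h0, m, k, rfl⟩
            (le_iSup (fun n => Φ.inv (1 / μ (φ^[m] ⁻¹' F k)) /
              Φ.inv (1 / μ (φ^[n] ⁻¹' (φ^[m] ⁻¹' F k)))) n)
        have hBp : (B : ℝ≥0∞) ≤ 2 ^ p := by exact_mod_cast hp.le
        exact (ENNReal.div_le_iff_le_mul (.inr (by simp)) (.inr (by simp))).1 (hle.trans hBp)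
    have hmod : ∀ m n, ∫⁻ x, Φ ((f : X →ₘ[μ] ℝ) (φ^[m + n] x)) ∂μ
        ≤ M * (K * ∫⁻ x, Φ ((f : X →ₘ[μ] ℝ) (φ^[m] x)) ∂μ) := by
      intro m n
      have hφm : ∀ l, Measurable φ^[l] := fun l => (hφ.iterate l).measurable
      have h1 := lintegral_young_le_of_dyadicLevel hK hfm (ν := μ.map φ^[m + n])
        (ρ := μ.map φ^[m]) (M := M) fun k => by
          rw [Measure.map_apply (hφm _) (measurableSet_dyadicLevel hfm k),
            Measure.map_apply (hφm _) (measurableSet_dyadicLevel hfm k)]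
          exact hmeas m n k
      have hmap : ∀ l, ∫⁻ x, Φ ((f : X →ₘ[μ] ℝ) x) ∂(μ.map φ^[l])
          = ∫⁻ x, Φ ((f : X →ₘ[μ] ℝ) (φ^[l] x)) ∂μ := fun l =>
        lintegral_map (Φ.measurable.comp hfm) (hφm l)
      rwa [hmap, hmap] at h1
    -- The modular is small along a subsequence, hence along the whole orbit, and by `Δ₂` so is
    -- the norm; this contradicts the positive upper limit.
    have hlim : Tendsto (fun n => ‖T^[n] f‖) atTop (𝓝 0) := by
      refine Metric.tendsto_atTop.2 fun ε hε => ?_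
      obtain ⟨q, hq⟩ := exists_pow_lt_of_lt_one hε (one_half_lt_one (α := ℝ))
      set δ : ℝ≥0 := 1 / (K ^ q * (M * K) + 1) with hδ
      have hδ0 : (0 : ℝ) < δ := by rw [hδ]; positivity
      have hδ1 : K ^ q * (M * K) * δ ≤ 1 := by
        rw [hδ, mul_one_div]
        exact div_le_one_of_le₀ le_self_add zero_le
      have hδ1' : (δ : ℝ) ≤ 1 := by
        rw [hδ]
        exact_mod_cast div_le_one_of_le₀ le_add_self zero_le
      obtain ⟨m, hm⟩ := (hfreq δ hδ0).exists
      have hsmall : ∫⁻ x, Φ ((f : X →ₘ[μ] ℝ) (φ^[m] x)) ∂μ ≤ δ := by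
        calc ∫⁻ x, Φ ((f : X →ₘ[μ] ℝ) (φ^[m] x)) ∂μ
            = ∫⁻ x, Φ (δ * ((T^[m] f : X →ₘ[μ] ℝ) x / δ)) ∂μ := by
              refine lintegral_congr_ae ?_
              filter_upwards [coeFn_iterate_compositionOperator (hmaps := hmaps) f m] with x hx
              rw [hx, mul_div_cancel₀ _ hδ0.ne', Function.comp_apply]
          _ ≤ ENNReal.ofReal δ * ∫⁻ x, Φ ((T^[m] f : X →ₘ[μ] ℝ) x / δ) ∂μ :=
              lintegral_young_mul_le Φ μ hδ0.le hδ1' _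
          _ ≤ ENNReal.ofReal δ * 1 := by
              gcongr
              exact lintegral_le_one_of_norm_lt _ hm
          _ = δ := by rw [mul_one, ENNReal.ofReal_coe_nnreal]
      refine ⟨m, fun n hn => ?_⟩
      obtain ⟨l, rfl⟩ := Nat.exists_eq_add_of_le hn
      rw [dist_zero_right, norm_norm]
      refine lt_of_le_of_lt (norm_le_of_lintegral_le_one _ (by positivity) ?_) hq
      calc ∫⁻ x, Φ ((T^[m + l] f : X →ₘ[μ] ℝ) x / (1 / 2) ^ q) ∂μ
          ≤ ∫⁻ x, (K : ℝ≥0∞) ^ q * Φ ((f : X →ₘ[μ] ℝ) (φ^[m + l] x)) ∂μ := by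
            refine lintegral_mono_ae ?_
            filter_upwards [coeFn_iterate_compositionOperator (hmaps := hmaps) f (m + l)]
              with x hx
            rw [hx, one_div, inv_pow, div_inv_eq_mul, mul_comm]
            exact YoungFunction.apply_two_pow_mul_le hK _ _
        _ = (K : ℝ≥0∞) ^ q * ∫⁻ x, Φ ((f : X →ₘ[μ] ℝ) (φ^[m + l] x)) ∂μ :=
            lintegral_const_mul' _ _ (by simp)
        _ ≤ (K : ℝ≥0∞) ^ q * (M * (K * δ)) := by
            gcongr
            exact (hmod m l).trans (by gcongr)
        _ = ((K ^ q * (M * K) * δ : ℝ≥0) : ℝ≥0∞) := by push_cast; ring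
        _ ≤ 1 := by exact_mod_cast hδ1
    have h1 := (ENNReal.tendsto_ofReal hlim).limsup_eq
    rw [ENNReal.ofReal_zero] at h1
    exact hsup.ne' h1

end Converse

theorem mainTheorem1 {X : Type*} [MeasurableSpace X] (μ : Measure X) (Φ : YoungFunction)
    (φ : X → X) (hφ : Measure.QuasiMeasurePreserving φ μ μ)
    (hmaps : ∀ f ∈ orliczSpace Φ μ, f.compQuasiMeasurePreserving φ hφ ∈ orliczSpace Φ μ)
    (hcont : Continuous (compositionOperator Φ μ φ hφ hmaps)) :
    (SetCondition Φ μ φ → LiYorkeChaotic (compositionOperator Φ μ φ hφ hmaps)) ∧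
    (Φ.GlobalDelta2 →
      (LiYorkeChaotic (compositionOperator Φ μ φ hφ hmaps) ↔ SetCondition Φ μ φ)) :=
  ⟨liYorkeChaotic_of_setCondition hcont, fun hΔ =>
    ⟨setCondition_of_liYorkeChaotic hcont hΔ, liYorkeChaotic_of_setCondition hcont⟩⟩
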